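/- **Setting.** Let $\mathcal M$ be a finite-dimensional smooth (Hausdorff) Riemannian manifold, let $d:\mathcal M\times\mathcal M\to\mathbb R_{\ge 0}$ be a distance function (positive, symmetric, with the triangle inequality; not necessarily the Riemannian distance), and let $\mathcal C\subseteq\mathcal M$ be *geodesically convex* (any two points of $\mathcal C$ are joined by a minimizing geodesic contained in $\mathcal C$) and *uniquely geodesic* (between two points of $\mathcal C$ there is only one geodesic $[0,1]\to\mathcal M$ contained in $\mathcal C$). For $x,y\in\mathcal C$ let $\gamma_{x,y}:[0,1]\to\mathcal C$ be this geodesic and $\operatorname{Exp}_x^{-1}(y):=\gamma_{x,y}'(0)\in T_x\mathcal M$. $\Gamma_x^{y}$ denotes Levi-Civita parallel transport from $T_x\mathcal M$ to $T_y\mathcal M$ along the geodesic under consideration. For $\alpha>0$, $\mathcal C$ is *double geodesically $\alpha$-strongly convex* w.r.t. $d$ if for all $x,y\in\mathcal C$, all $t\in[0,1]$ and all $z\in T_{\gamma(t)}\mathcal M$, $\gamma=\gamma_{x,y}$, with $\|z\|_{\gamma(t)}\le\alpha t(1-t)d^2(x,y)$, the point $\operatorname{Exp}_{\gamma(t)}(z)$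 exists and is in $\mathcal C$. The double exponential map is $\operatorname{Exp}_x(u,\eta):=\operatorname{Exp}_{\operatorname{Exp}_x(u)}\big(\Gamma_x^{\operatorname{Exp}_x(u)}\eta\big)$, with transport along $t\mapsto\operatorname{Exp}_x(tu)$. An *exponential map operator* is a family $h_x:T_x\mathcal M\times T_x\mathcal M\to T_x\mathcal M$ $(x\in\mathcal C)$ with $\operatorname{Exp}_x(h_x(u,\eta))=\operatorname{Exp}_x(u,\eta)$ whenever the right-hand side exists and lies in the range of $\operatorname{Exp}_x$ (the latter is automatic if $\mathcal M$ is complete and connected), where for $\operatorname{Exp}_x(u,\eta)\in\mathcal C$ the preimage is the logarithm: $h_x(u,\eta)=\operatorname{Exp}_x^{-1}(\operatorname{Exp}_x(u,\eta))$. Put $R_x(u,\eta):=h_x(u,\eta)-u-\eta$. $\mathcal C$ satisfies the *approximate Riemannian scaling inequality* with constant $c$ and residual $r$ if, for all $x\in\mathcal C$, $w\in T_x\mathcal M$ and $v\in\operatorname{argmax}_{z\in\mathcal C}\langle w;\operatorname{Exp}_x^{-1}(z)\rangle_x$, $$\langle w;\operatorname{Exp}_x^{-1}(v)\rangle_x\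 \ge\ c\,\|w\|_x\,d(v,x)^2+\langle w;r(x)\rangle_x ,$$ where $r(x)\in T_x\mathcal M$ may also depend on $w$ and $v$. **Proposition.** Let $\mathcal C$ be double geodesically $\alpha$-strongly convex w.r.t. $d$, let $h$ be an exponential map operator, written $h_x(u,\eta)=u+\eta+R_x(u,\eta)$, and for $x\in\mathcal C$, $w\in T_x\mathcal M$, $v\in\operatorname{argmax}_{z\in\mathcal C}\langle w;\operatorname{Exp}_x^{-1}(z)\rangle_x$ let $$r(x)=R_x\Big[\tfrac12\gamma_{x,v}'(0),\ \Gamma^{x}_{\gamma_{x,v}(1/2)}\Big(\tfrac{\alpha}{4}d^2(x,v)\,z^*\Big)\Big],\qquad z^*\in\operatorname*{argmax}_{\|z\|_{\gamma_{x,v}(1/2)}=1}\big\langle\Gamma_x^{\gamma_{x,v}(1/2)}w;z\big\rangle_{\gamma_{x,v}(1/2)},$$ for any choice of the maximizer $z^*$. Then $\mathcal C$ satisfies the approximate Riemannian scaling inequality with constant $\alpha/4$ and residual $r$, and also with constant $\alpha/2$ and residual $2r$; that is, $$\langle w;\operatorname{Exp}_x^{-1}(v)\rangle_x\ge\tfrac{\alpha}{4}\|w\|_x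 d^2(x,v)+\langle w;r(x)\rangle_x\quad\text{and}\quad \langle w;\operatorname{Exp}_x^{-1}(v)\rangle_x\ge\tfrac{\alpha}{2}\|w\|_x d^2(x,v)+2\langle w;r(x)\rangle_x .$$ -/

import Mathlib

open Set Bundle Manifold
open scoped ContDiff

noncomputable section

namespace DoubleGeodesic

variable {E : Type*} [NormedAddCommGroup E] [NormedSpace ℝ E]
  {M : Type*} [TopologicalSpace M] [ChartedSpace E M] [IsManifold 𝓘(ℝ, E) ∞ M]

/-! ### Levi-Civita connection along curves, in charts

Curves `[0,1] → M` are represented by maps `ℝ → M` of which only the restriction to `Icc 0 1`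
matters; all derivatives are taken within `Icc 0 1`. -/

/-- The velocity `γ'(t)` of a curve `γ : [0,1] → M`. -/
def velocity (γ : ℝ → M) (t : ℝ) : TangentSpace 𝓘(ℝ, E) (γ t) :=
  mfderivWithin 𝓘(ℝ, ℝ) 𝓘(ℝ, E) γ (Icc 0 1) t (1 : ℝ)

/-- The components, in the chart at `p`, of a vector field `V` along a curve `γ`. -/
def chartRep (p : M) (γ : ℝ → M) (V : ∀ t, TangentSpace 𝓘(ℝ, E) (γ t)) (t : ℝ) : E :=
  mfderiv 𝓘(ℝ, E) 𝓘(ℝ, E) (extChartAt 𝓘(ℝ, E) p) (γ t) (V t)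

variable [RiemannianBundle (fun x : M ↦ TangentSpace 𝓘(ℝ, E) x)]

/-- The metric in the chart at `p`: `chartMetric p y a b` is `∑ g_ij(y) a^i b^j`. -/
def chartMetric (p : M) (y a b : E) : ℝ :=
  inner ℝ
    (mfderiv 𝓘(ℝ, E) 𝓘(ℝ, E) (extChartAt 𝓘(ℝ, E) p).symm y a :
      TangentSpace 𝓘(ℝ, E) ((extChartAt 𝓘(ℝ, E) p).symm y))
    (mfderiv 𝓘(ℝ, E) 𝓘(ℝ, E) (extChartAt 𝓘(ℝ, E) p).symm y b :
      TangentSpace 𝓘(ℝ, E) ((extChartAt 𝓘(ℝ, E) p).symm y))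

/-- The Christoffel symbol of the first kind in the chart at `p`:
`½ (∂_a g(b,c) + ∂_b g(a,c) - ∂_c g(a,b))`, which is `g(Γ(a,b), c)` for the Levi-Civita
connection. -/
def christoffel (p : M) (y a b c : E) : ℝ :=
  (1 / 2) * (fderiv ℝ (fun y' ↦ chartMetric p y' b c) y a
    + fderiv ℝ (fun y' ↦ chartMetric p y' a c) y b
    - fderiv ℝ (fun y' ↦ chartMetric p y' a b) y c)

/-- `V` is a parallel vector field along `γ : [0,1] → M` for the Levi-Civita connection:
`D_t V = V' + Γ(γ', V)` vanishes, where both sides are computed at time `t` in the chart at `γ t`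
and paired through the metric with an arbitrary vector `e`. -/
def IsParallelAlong (γ : ℝ → M) (V : ∀ t, TangentSpace 𝓘(ℝ, E) (γ t)) : Prop :=
  ∀ t ∈ Icc (0 : ℝ) 1,
    DifferentiableWithinAt ℝ (chartRep (γ t) γ V) (Icc 0 1) t ∧
    ∀ e : E,
      chartMetric (γ t) (extChartAt 𝓘(ℝ, E) (γ t) (γ t))
          (derivWithin (chartRep (γ t) γ V) (Icc 0 1) t) e
        + christoffel (γ t) (extChartAt 𝓘(ℝ, E) (γ t) (γ t))
          (chartRep (γ t) γ (velocity γ) t) (chartRep (γ t) γ V t) e = 0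

/-- `γ : [0,1] → M` is a (Riemannian) geodesic: it is smooth and its velocity is parallel. -/
def IsGeodesic (γ : ℝ → M) : Prop :=
  ContMDiffOn 𝓘(ℝ, ℝ) 𝓘(ℝ, E) ∞ γ (Icc 0 1) ∧ IsParallelAlong γ (velocity (E := E) γ)

/-- The tangent vector `b` is the parallel transport of the tangent vector `a` along `γ`, from time
`s` to time `t`. -/
def IsParallelTransport (γ : ℝ → M) (s t : ℝ) (a b : TangentBundle 𝓘(ℝ, E) M) : Prop :=
  ∃ V : ∀ τ, TangentSpace 𝓘(ℝ, E) (γ τ), IsParallelAlong γ V ∧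
    (⟨γ s, V s⟩ : TangentBundle 𝓘(ℝ, E) M) = a ∧ (⟨γ t, V t⟩ : TangentBundle 𝓘(ℝ, E) M) = b

/-- `γ` is the geodesic `t ↦ Exp_x(t v)` on `[0,1]`, that is, `γ(0) = x` and `γ'(0) = v`. -/
def IsGeodesicFrom (γ : ℝ → M) (x : M) (v : TangentSpace 𝓘(ℝ, E) x) : Prop :=
  IsGeodesic (E := E) γ ∧
    (⟨γ 0, velocity γ 0⟩ : TangentBundle 𝓘(ℝ, E) M) = ⟨x, v⟩

/-- The graph of the (possibly only partially defined) exponential map: `Exp_x(v)` exists and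
equals `y`. -/
def IsExp (x : M) (v : TangentSpace 𝓘(ℝ, E) x) (y : M) : Prop :=
  ∃ γ : ℝ → M, IsGeodesicFrom γ x v ∧ γ 1 = y

/-- The graph of the double exponential map: `Exp_{Exp_x(u)}(Γ_x^{Exp_x(u)} η)` exists and equals
`y`, where `Γ` is parallel transport along the geodesic `t ↦ Exp_x(t u)`. -/
def IsDoubleExp (x : M) (u η : TangentSpace 𝓘(ℝ, E) x) (y : M) : Prop :=
  ∃ (σ : ℝ → M) (η' : TangentSpace 𝓘(ℝ, E) (σ 1)), IsGeodesicFrom σ x u ∧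
    IsParallelTransport σ 0 1 ⟨x, η⟩ ⟨σ 1, η'⟩ ∧ IsExp (σ 1) η' y

/-! ### Convexity of sets -/

/-- `γ` is a geodesic `[0,1] → M` contained in `C` with `γ(0) = x` and `γ(1) = y`. -/
def IsGeodesicInFromTo (E : Type*) [NormedAddCommGroup E] [NormedSpace ℝ E] [ChartedSpace E M]
    [IsManifold 𝓘(ℝ, E) ∞ M] [RiemannianBundle (fun x : M ↦ TangentSpace 𝓘(ℝ, E) x)]
    (C : Set M) (γ : ℝ → M) (x y : M) : Prop :=
  IsGeodesic (E := E) γ ∧ (∀ t ∈ Icc (0 : ℝ) 1, γ t ∈ C) ∧ γ 0 = x ∧ γ 1 = y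

/-- The length of `γ` is the Riemannian distance of its endpoints. -/
def IsMinimizing (E : Type*) [NormedAddCommGroup E] [NormedSpace ℝ E] [ChartedSpace E M]
    [IsManifold 𝓘(ℝ, E) ∞ M] [RiemannianBundle (fun x : M ↦ TangentSpace 𝓘(ℝ, E) x)]
    (γ : ℝ → M) : Prop :=
  pathELength 𝓘(ℝ, E) γ 0 1 = riemannianEDist 𝓘(ℝ, E) (γ 0) (γ 1)

/-- Any two points of `C` are joined by a minimizing geodesic contained in `C`. -/
def IsGeodesicallyConvex (E : Type*) [NormedAddCommGroup E] [NormedSpace ℝ E] [ChartedSpace E M]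
    [IsManifold 𝓘(ℝ, E) ∞ M] [RiemannianBundle (fun x : M ↦ TangentSpace 𝓘(ℝ, E) x)]
    (C : Set M) : Prop :=
  ∀ x ∈ C, ∀ y ∈ C, ∃ γ : ℝ → M, IsGeodesicInFromTo E C γ x y ∧ IsMinimizing E γ

/-- Between any two points of `C` there is only one geodesic contained in `C`. -/
def IsUniquelyGeodesic (E : Type*) [NormedAddCommGroup E] [NormedSpace ℝ E] [ChartedSpace E M]
    [IsManifold 𝓘(ℝ, E) ∞ M] [RiemannianBundle (fun x : M ↦ TangentSpace 𝓘(ℝ, E) x)]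
    (C : Set M) : Prop :=
  ∀ x ∈ C, ∀ y ∈ C, ∀ γ σ : ℝ → M,
    IsGeodesicInFromTo E C γ x y → IsGeodesicInFromTo E C σ x y → EqOn γ σ (Icc 0 1)

/-- A distance function on `M`, not necessarily the Riemannian one. -/
structure IsDistanceFunction {X : Type*} (d : X → X → ℝ) : Prop where
  nonneg : ∀ x y, 0 ≤ d x y
  eq_zero_iff : ∀ x y, d x y = 0 ↔ x = y
  symm : ∀ x y, d x y = d y x
  triangle : ∀ x y z, d x z ≤ d x y + d y z

/-- `C` is double geodesically `α`-strongly convex with respect to `d`: for every geodesic `γ` of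
`C` joining `x, y ∈ C`, every `t ∈ [0,1]` and every `z ∈ T_{γ(t)}M` with
`‖z‖ ≤ α t (1 - t) d(x,y)²`, the point `Exp_{γ(t)}(z)` exists and is in `C`. -/
def IsDoubleGeodesicallyStronglyConvex (E : Type*) [NormedAddCommGroup E] [NormedSpace ℝ E]
    [ChartedSpace E M] [IsManifold 𝓘(ℝ, E) ∞ M]
    [RiemannianBundle (fun x : M ↦ TangentSpace 𝓘(ℝ, E) x)]
    (C : Set M) (d : M → M → ℝ) (α : ℝ) : Prop :=
  ∀ x ∈ C, ∀ y ∈ C, ∀ γ : ℝ → M, IsGeodesicInFromTo E C γ x y →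
    ∀ t ∈ Icc (0 : ℝ) 1, ∀ z : TangentSpace 𝓘(ℝ, E) (γ t),
      ‖z‖ ≤ α * t * (1 - t) * d x y ^ 2 → ∃ p ∈ C, IsExp (γ t) z p

/-! ### Logarithm, exponential map operator, scaling inequality -/

/-- The initial velocities of the minimizing geodesics from `x` to `y` that are contained in `C`.
If `C` is geodesically convex and uniquely geodesic and `x, y ∈ C`, there is exactly one. -/
def logSet (C : Set M) (x y : M) : Set (TangentSpace 𝓘(ℝ, E) x) :=
  {v | ∃ γ : ℝ → M, IsGeodesicFrom γ x v ∧ IsGeodesicInFromTo E C γ x y ∧ IsMinimizing E γ}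

open Classical in
/-- The logarithm `Exp_x⁻¹ : C → T_xM` of `C` at `x ∈ C`, the inverse of the exponential map
restricted to the velocities of minimizing geodesics of `C`. -/
def logMap (C : Set M) (x y : M) : TangentSpace 𝓘(ℝ, E) x :=
  if h : (logSet (E := E) C x y).Nonempty then h.some else 0

/-- `v ∈ argmax_{z ∈ C} ⟨w, Exp_x⁻¹(z)⟩_x`. -/
def IsLinearMaximizer (C : Set M) (x : M) (w : TangentSpace 𝓘(ℝ, E) x) (v : M) : Prop :=
  v ∈ C ∧ ∀ z ∈ C, inner ℝ w (logMap C x z) ≤ inner ℝ w (logMap C x v)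

/-- `h` is an exponential map operator: `Exp_x(h_x(u,η))` is the double exponential of `(u,η)`
at `x` (as soon as that point is in the range of `Exp_x`, which is automatic if `M` is complete and
connected), where, among the preimages, the logarithm of `C` is taken for points of `C`. -/
def IsExpOperator (C : Set M)
    (h : ∀ x : M, TangentSpace 𝓘(ℝ, E) x → TangentSpace 𝓘(ℝ, E) x → TangentSpace 𝓘(ℝ, E) x) :
    Prop :=
  ∀ x ∈ C, ∀ (u η : TangentSpace 𝓘(ℝ, E) x) (y : M), IsDoubleExp x u η y →
    ((∃ ζ : TangentSpace 𝓘(ℝ, E) x, IsExp x ζ y) → IsExp x (h x u η) y) ∧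
    (y ∈ C → h x u η = logMap C x y)

/-- The approximate Riemannian scaling inequality with constant `c` and residual `r`. The residual
at `x` may depend on the direction `w` and the maximizer `v`. -/
def ApproxScalingInequality (C : Set M) (d : M → M → ℝ) (c : ℝ)
    (r : ∀ x : M, TangentSpace 𝓘(ℝ, E) x → M → TangentSpace 𝓘(ℝ, E) x) : Prop :=
  ∀ x ∈ C, ∀ (w : TangentSpace 𝓘(ℝ, E) x) (v : M), IsLinearMaximizer C x w v →
    c * ‖w‖ * d v x ^ 2 + inner ℝ w (r x w v) ≤ inner ℝ w (logMap C x v)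

/-- `ρ = R_x(½ γ'(0), Γ_{γ(1/2)}^x ((α/4) d(x,v)² z))`, where `γ` is the geodesic of `C` from `x`
to `v` and `z` maximizes `⟨Γ_x^{γ(1/2)} w, z⟩` over the unit sphere of `T_{γ(1/2)}M`.
Here `u = γ'(0)`, `w'` is the transport of `w` and `η` that of `(α/4) d(x,v)² z`. -/
def IsResidual (C : Set M) (d : M → M → ℝ) (α : ℝ)
    (R : ∀ x : M, TangentSpace 𝓘(ℝ, E) x → TangentSpace 𝓘(ℝ, E) x → TangentSpace 𝓘(ℝ, E) x)
    (x : M) (w : TangentSpace 𝓘(ℝ, E) x) (v : M) (ρ : TangentSpace 𝓘(ℝ, E) x) : Prop :=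
  ∃ (γ : ℝ → M) (u η : TangentSpace 𝓘(ℝ, E) x) (w' z : TangentSpace 𝓘(ℝ, E) (γ (1 / 2))),
    IsGeodesicInFromTo E C γ x v ∧ IsGeodesicFrom γ x u ∧
    IsParallelTransport γ 0 (1 / 2) ⟨x, w⟩ ⟨γ (1 / 2), w'⟩ ∧
    ‖z‖ = 1 ∧
    (∀ ζ : TangentSpace 𝓘(ℝ, E) (γ (1 / 2)), ‖ζ‖ = 1 → inner ℝ w' ζ ≤ inner ℝ w' z) ∧
    IsParallelTransport γ (1 / 2) 0 ⟨γ (1 / 2), (α / 4 * d x v ^ 2) • z⟩ ⟨x, η⟩ ∧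
    ρ = R x ((1 / 2 : ℝ) • u) η

end DoubleGeodesic

end

/-! Test the maximality of `v` against one point of `C`. Let `γ` be the geodesic from `x` to `v` and
`u = γ'(0)`, so `u` is the logarithm of `v`. From the midpoint, shoot along `(α/4) d(x,v)² z*`.
Since `α t (1 - t) = α/4` at `t = 1/2`, strong convexity gives an endpoint `p` in `C`.

This `p` is the double exponential at `x` of `(u/2, η)`, where `η` is that vector transported back
to `x`. Hence its logarithm is `u/2 + η + r`. Transport is isometric and `z*` maximizes the pairing
with the transported `w`, so `⟨w, η⟩ = (α/4) d(x,v)² ‖w‖`. Then `⟨w, log p⟩ ≤ ⟨w, u⟩` reads `(α/4)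
‖w‖ d² + ⟨w, r⟩ ≤ ½ ⟨w, u⟩`. Doubling gives the constant `α/2`; for `α/4`, use `⟨w, u⟩ ≥ 0`, as `x`
itself is a competitor.

The geometric input is that parallel fields have constant inner product
(`IsParallelAlong.inner_eq`), that geodesics and parallel fields survive the rescaling `t ↦ a t`
(`isDoubleExp_of_isExp`), and that the logarithm is the velocity of any geodesic in `C`
(`logMap_eq`). -/

namespace DoubleGeodesic

variable {E : Type*} [NormedAddCommGroup E] [NormedSpace ℝ E]
  {M : Type*} [TopologicalSpace M] [ChartedSpace E M]

/-! ### The metric and Christoffel symbols in a chart. -/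

section ChartMetric

variable [RiemannianBundle (fun x : M ↦ TangentSpace 𝓘(ℝ, E) x)]

theorem chartMetric_add_left (p : M) (y a a' b : E) :
    chartMetric p y (a + a') b = chartMetric p y a b + chartMetric p y a' b := by
  unfold chartMetric
  rw [← inner_add_left]
  congr 1
  exact map_add (mfderiv 𝓘(ℝ, E) 𝓘(ℝ, E) (extChartAt 𝓘(ℝ, E) p).symm y) a a'

theorem chartMetric_smul_left (p : M) (y : E) (c : ℝ) (a b : E) :
    chartMetric p y (c • a) b = c * chartMetric p y a b := by
  unfold chartMetric
  rw [← real_inner_smul_left]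
  congr 1
  exact map_smul (mfderiv 𝓘(ℝ, E) 𝓘(ℝ, E) (extChartAt 𝓘(ℝ, E) p).symm y) c a

theorem chartMetric_comm (p : M) (y a b : E) : chartMetric p y a b = chartMetric p y b a :=
  real_inner_comm _ _

theorem chartMetric_add_right (p : M) (y a b b' : E) :
    chartMetric p y a (b + b') = chartMetric p y a b + chartMetric p y a b' := by
  simp only [chartMetric_comm p y a, chartMetric_add_left]

theorem chartMetric_smul_right (p : M) (y : E) (c : ℝ) (a b : E) :
    chartMetric p y a (c • b) = c * chartMetric p y a b := by
  simp only [chartMetric_comm p y a, chartMetric_smul_left]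

/-- Metric compatibility in coordinates: the other two derivatives cancel by symmetry of the metric.
-/
theorem christoffel_add_christoffel (p : M) (y a b c : E) :
    christoffel p y a b c + christoffel p y a c b =
      fderiv ℝ (fun y' ↦ chartMetric p y' b c) y a := by
  unfold christoffel
  simp only [chartMetric_comm p _ c b]
  ring

variable [IsManifold 𝓘(ℝ, E) ∞ M]

/-- The chart at `p` is an isometry from the metric of `M` to `chartMetric p`. -/
theorem chartMetric_mfderiv {p q : M} (hq : q ∈ (extChartAt 𝓘(ℝ, E) p).source)
    (a b : TangentSpace 𝓘(ℝ, E) q) :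
    chartMetric p (extChartAt 𝓘(ℝ, E) p q) (mfderiv 𝓘(ℝ, E) 𝓘(ℝ, E) (extChartAt 𝓘(ℝ, E) p) q a)
      (mfderiv 𝓘(ℝ, E) 𝓘(ℝ, E) (extChartAt 𝓘(ℝ, E) p) q b) = inner ℝ a b := by
  obtain ⟨y, hy, rfl⟩ : ∃ y ∈ (extChartAt 𝓘(ℝ, E) p).target, (extChartAt 𝓘(ℝ, E) p).symm y = q :=
    ⟨_, (extChartAt 𝓘(ℝ, E) p).map_source hq, (extChartAt 𝓘(ℝ, E) p).left_inv hq⟩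
  rw [(extChartAt 𝓘(ℝ, E) p).right_inv hy]
  have : IsManifold 𝓘(ℝ, E) 1 M := IsManifold.of_le (n := ∞) (by simp)
  have key := mfderivWithin_extChartAt_symm_comp_mfderiv_extChartAt (I := 𝓘(ℝ, E)) hy
  rw [modelWithCornersSelf_coe, range_id, mfderivWithin_univ] at key
  unfold chartMetric
  have h (a) := DFunLike.congr_fun key a
  congr 1
  · exact h a
  · exact h b

variable [IsContMDiffRiemannianBundle 𝓘(ℝ, E) ∞ E (fun x : M ↦ TangentSpace 𝓘(ℝ, E) x)]

/-- The coordinate fields are images of constant fields under the tangent map of the inverse chart,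
hence smooth, and so are their inner products. -/
theorem differentiableAt_chartMetric (p : M) {y : E} (hy : y ∈ (extChartAt 𝓘(ℝ, E) p).target)
    (a b : E) : DifferentiableAt ℝ (fun y' ↦ chartMetric p y' a b) y := by
  have hopen : IsOpen (extChartAt 𝓘(ℝ, E) p).target := isOpen_extChartAt_target p
  have hsymm : ContMDiffOn 𝓘(ℝ, E) 𝓘(ℝ, E) ∞ (extChartAt 𝓘(ℝ, E) p).symm
      (extChartAt 𝓘(ℝ, E) p).target := contMDiffOn_extChartAt_symm p
  have htan := hsymm.contMDiffOn_tangentMapWithin (m := ∞) (by simp) hopen.uniqueMDiffOn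
  have hsec (c : E) : ContMDiffOn 𝓘(ℝ, E) (𝓘(ℝ, E).prod 𝓘(ℝ, E)) ∞
      (fun y' ↦ (⟨(extChartAt 𝓘(ℝ, E) p).symm y',
        mfderiv 𝓘(ℝ, E) 𝓘(ℝ, E) (extChartAt 𝓘(ℝ, E) p).symm y' c⟩ : TangentBundle 𝓘(ℝ, E) M))
      (extChartAt 𝓘(ℝ, E) p).target := by
    have hc : ContMDiff 𝓘(ℝ, E) (𝓘(ℝ, E).prod 𝓘(ℝ, E)) ∞
        (fun y' : E ↦ (⟨y', c⟩ : TangentBundle 𝓘(ℝ, E) E)) :=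
      contMDiff_vectorSpace_iff_contDiff.2 contDiff_const
    refine (htan.comp hc.contMDiffOn (fun y' hy' ↦ hy')).congr fun y' hy' ↦ ?_
    simp only [Function.comp, tangentMapWithin]
    rw [mfderivWithin_of_isOpen hopen hy']
  have := (ContMDiffOn.inner_bundle (E := fun x : M ↦ TangentSpace 𝓘(ℝ, E) x)
    (h := ‹IsContMDiffRiemannianBundle 𝓘(ℝ, E) ∞ E (fun x : M ↦ TangentSpace 𝓘(ℝ, E) x)›)
    (v := fun y' ↦ mfderiv 𝓘(ℝ, E) 𝓘(ℝ, E) (extChartAt 𝓘(ℝ, E) p).symm y' a)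
    (w := fun y' ↦ mfderiv 𝓘(ℝ, E) 𝓘(ℝ, E) (extChartAt 𝓘(ℝ, E) p).symm y' b)
    (hsec a) (hsec b)).contDiffOn
  exact (this.contDiffAt (hopen.mem_nhds hy)).differentiableAt (by simp)

theorem christoffel_smul_left (p : M) {y : E} (hy : y ∈ (extChartAt 𝓘(ℝ, E) p).target)
    (k : ℝ) (a b c : E) : christoffel p y (k • a) b c = k * christoffel p y a b c := by
  unfold christoffel
  simp only [chartMetric_smul_left, fderiv_const_mul (differentiableAt_chartMetric p hy _ _)]
  simp
  ring

theorem christoffel_smul_middle (p : M) {y : E} (hy : y ∈ (extChartAt 𝓘(ℝ, E) p).target)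
    (k : ℝ) (a b c : E) : christoffel p y a (k • b) c = k * christoffel p y a b c := by
  unfold christoffel
  simp only [chartMetric_smul_left, chartMetric_smul_right,
    fderiv_const_mul (differentiableAt_chartMetric p hy _ _)]
  simp
  ring

variable [FiniteDimensional ℝ E]

/-- The product rule for the metric in a chart. -/
theorem hasDerivWithinAt_chartMetric (p : M) {s : Set ℝ} {t : ℝ} {c V W : ℝ → E} {c' V' W' : E}
    (hct : c t ∈ (extChartAt 𝓘(ℝ, E) p).target) (hc : HasDerivWithinAt c c' s t)
    (hV : HasDerivWithinAt V V' s t) (hW : HasDerivWithinAt W W' s t) :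
    HasDerivWithinAt (fun τ ↦ chartMetric p (c τ) (V τ) (W τ))
      (fderiv ℝ (fun y' ↦ chartMetric p y' (V t) (W t)) (c t) c' + chartMetric p (c t) V' (W t)
        + chartMetric p (c t) (V t) W') s t := by
  let b := Module.finBasis ℝ E
  -- In a basis the metric becomes a finite sum of products of scalar functions, to which the
  -- ordinary product rule applies.
  have expand (y a a' : E) : chartMetric p y a a' =
      ∑ i, ∑ j, b.repr a i * (b.repr a' j * chartMetric p y (b i) (b j)) := by
    let B : E →ₗ[ℝ] E →ₗ[ℝ] ℝ := LinearMap.mk₂ ℝ (chartMetric p y) (chartMetric_add_left p y)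
      (fun c a a' ↦ chartMetric_smul_left p y c a a') (chartMetric_add_right p y)
      (fun c a a' ↦ chartMetric_smul_right p y c a a')
    change B a a' = ∑ i, ∑ j, b.repr a i * (b.repr a' j * B (b i) (b j))
    conv_lhs => rw [← b.sum_repr a, ← b.sum_repr a']
    simp only [map_sum, map_smul, LinearMap.sum_apply, LinearMap.smul_apply, smul_eq_mul,
      Finset.mul_sum]
    rw [Finset.sum_comm]
    refine Finset.sum_congr rfl fun i _ ↦ Finset.sum_congr rfl fun j _ ↦ ?_
    ring
  have coord {V : ℝ → E} {V' : E} (hV : HasDerivWithinAt V V' s t) (i) :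
      HasDerivWithinAt (fun τ ↦ b.repr (V τ) i) (b.repr V' i) s t :=
    (LinearMap.toContinuousLinearMap (b.coord i)).hasFDerivAt.comp_hasDerivWithinAt t hV
  have hg (i j) := (differentiableAt_chartMetric p hct (b i) (b j)).hasFDerivAt
  have hfd : fderiv ℝ (fun y' ↦ chartMetric p y' (V t) (W t)) (c t) c' =
      ∑ i, ∑ j, b.repr (V t) i * (b.repr (W t) j *
        fderiv ℝ (fun y' ↦ chartMetric p y' (b i) (b j)) (c t) c') := by
    have : HasFDerivAt (fun y' ↦ chartMetric p y' (V t) (W t))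
        (∑ i, ∑ j, b.repr (V t) i • (b.repr (W t) j •
          fderiv ℝ (fun y' ↦ chartMetric p y' (b i) (b j)) (c t))) (c t) := by
      simp_rw [expand _ (V t) (W t)]
      exact HasFDerivAt.fun_sum fun i _ ↦ HasFDerivAt.fun_sum fun j _ ↦
        ((hg i j).const_mul _).const_mul _
    rw [this.fderiv]
    simp
  have main : HasDerivWithinAt (fun τ ↦ ∑ i, ∑ j, b.repr (V τ) i *
      (b.repr (W τ) j * chartMetric p (c τ) (b i) (b j))) _ s t :=
    HasDerivWithinAt.fun_sum fun i _ ↦ HasDerivWithinAt.fun_sum fun j _ ↦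
      (coord hV i).mul ((coord hW j).mul ((hg i j).comp_hasDerivWithinAt t hc))
  simp_rw [← expand] at main
  refine main.congr_deriv ?_
  rw [hfd, expand _ V' (W t), expand _ (V t) W']
  simp_rw [← Finset.sum_add_distrib]
  refine Finset.sum_congr rfl fun i _ ↦ Finset.sum_congr rfl fun j _ ↦ ?_
  ring

end ChartMetric

/-! ### Rescaling of time, and constancy of inner products of parallel fields. -/

section Reparametrization

theorem mul_mem_Icc_zero_one {a t : ℝ} (ha : a ∈ Icc (0 : ℝ) 1) (ht : t ∈ Icc (0 : ℝ) 1) :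
    a * t ∈ Icc (0 : ℝ) 1 :=
  ⟨mul_nonneg ha.1 ht.1, mul_le_one₀ ha.2 ht.1 ht.2⟩

theorem hasDerivWithinAt_comp_mul_left {F : Type*} [NormedAddCommGroup F] [NormedSpace ℝ F]
    {f : ℝ → F} {f' : F} {a t : ℝ} (ha : a ∈ Icc (0 : ℝ) 1)
    (hf : HasDerivWithinAt f f' (Icc 0 1) (a * t)) :
    HasDerivWithinAt (fun s ↦ f (a * s)) (a • f') (Icc 0 1) t := by
  have h : HasDerivWithinAt (fun s ↦ a * s) a (Icc 0 1) t := by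
    simpa using (hasDerivWithinAt_id t (Icc 0 1)).const_mul a
  exact hf.scomp t h fun s hs ↦ mul_mem_Icc_zero_one ha hs

theorem velocity_comp_mul_left {γ : ℝ → M} {a t : ℝ} (ha : a ∈ Icc (0 : ℝ) 1)
    (ht : t ∈ Icc (0 : ℝ) 1)
    (hγ : MDifferentiableWithinAt 𝓘(ℝ, ℝ) 𝓘(ℝ, E) γ (Icc 0 1) (a * t)) :
    velocity (E := E) (fun s ↦ γ (a * s)) t = a • velocity (E := E) γ (a * t) := by
  have hmul : HasMFDerivWithinAt 𝓘(ℝ, ℝ) 𝓘(ℝ, ℝ) (fun s ↦ a * s) (Icc 0 1) t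
      (a • ContinuousLinearMap.id ℝ ℝ : ℝ →L[ℝ] ℝ) :=
    ((hasFDerivWithinAt_id t (Icc 0 1)).const_mul a).hasMFDerivWithinAt
  have := HasMFDerivWithinAt.comp t hγ.hasMFDerivWithinAt hmul
    fun s hs ↦ mul_mem_Icc_zero_one ha hs
  have huniq : UniqueMDiffWithinAt 𝓘(ℝ, ℝ) (Icc (0 : ℝ) 1) t :=
    (uniqueDiffOn_Icc_zero_one t ht).uniqueMDiffWithinAt
  have h1 := this.mfderivWithin huniq
  unfold velocity
  have h2 := DFunLike.congr_fun h1 (1 : ℝ)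
  refine h2.trans ?_
  change mfderivWithin 𝓘(ℝ, ℝ) 𝓘(ℝ, E) γ (Icc 0 1) (a * t) (a • (1 : ℝ)) = _
  exact map_smul (mfderivWithin 𝓘(ℝ, ℝ) 𝓘(ℝ, E) γ (Icc 0 1) (a * t)) a (1 : ℝ)

theorem chartRep_smul (p : M) (γ : ℝ → M) (V : ∀ t, TangentSpace 𝓘(ℝ, E) (γ t)) (a t : ℝ) :
    chartRep p γ (fun τ ↦ a • V τ) t = a • chartRep p γ V t :=
  map_smul (mfderiv 𝓘(ℝ, E) 𝓘(ℝ, E) (extChartAt 𝓘(ℝ, E) p) (γ t)) a (V t)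

section Chart

variable [IsManifold 𝓘(ℝ, E) ∞ M]

/-- The components of the velocity are the derivatives of the coordinates of the curve. -/
theorem hasDerivWithinAt_extChartAt_comp {p : M} {γ : ℝ → M} {t : ℝ}
    (hp : γ t ∈ (extChartAt 𝓘(ℝ, E) p).source)
    (hγ : MDifferentiableWithinAt 𝓘(ℝ, ℝ) 𝓘(ℝ, E) γ (Icc 0 1) t) :
    HasDerivWithinAt (fun τ ↦ extChartAt 𝓘(ℝ, E) p (γ τ)) (chartRep p γ (velocity γ) t)
      (Icc 0 1) t := by
  have : IsManifold 𝓘(ℝ, E) 1 M := IsManifold.of_le (n := ∞) (by simp)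
  rw [extChartAt_source] at hp
  have := (mdifferentiableAt_extChartAt (I := 𝓘(ℝ, E)) hp).hasMFDerivAt.comp_hasMFDerivWithinAt t
    hγ.hasMFDerivWithinAt
  obtain ⟨L, hL1, hL⟩ : ∃ L : ℝ →L[ℝ] E, L 1 = chartRep p γ (velocity γ) t ∧
      HasFDerivWithinAt (fun τ ↦ extChartAt 𝓘(ℝ, E) p (γ τ)) L (Icc 0 1) t :=
    ⟨_, rfl, this.hasFDerivWithinAt⟩
  exact hL1 ▸ hL.hasDerivWithinAt

end Chart

variable [RiemannianBundle (fun x : M ↦ TangentSpace 𝓘(ℝ, E) x)]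

theorem IsGeodesic.mdifferentiableWithinAt {γ : ℝ → M} (hγ : IsGeodesic (E := E) γ) {t : ℝ}
    (ht : t ∈ Icc (0 : ℝ) 1) : MDifferentiableWithinAt 𝓘(ℝ, ℝ) 𝓘(ℝ, E) γ (Icc 0 1) t :=
  (hγ.1 t ht).mdifferentiableWithinAt (by simp)

theorem IsParallelAlong.congr {γ : ℝ → M} {V W : ∀ t, TangentSpace 𝓘(ℝ, E) (γ t)}
    (hV : IsParallelAlong γ V) (h : ∀ t ∈ Icc (0 : ℝ) 1, W t = V t) : IsParallelAlong γ W := by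
  intro t ht
  have hrep : EqOn (chartRep (γ t) γ W) (chartRep (γ t) γ V) (Icc 0 1) := fun τ hτ ↦ by
    unfold chartRep
    rw [h τ hτ]
  obtain ⟨h1, h2⟩ := hV t ht
  refine ⟨h1.congr hrep (hrep ht), fun e ↦ ?_⟩
  rw [derivWithin_congr hrep (hrep ht), hrep ht]
  exact h2 e

variable [IsManifold 𝓘(ℝ, E) ∞ M]
  [IsContMDiffRiemannianBundle 𝓘(ℝ, E) ∞ E (fun x : M ↦ TangentSpace 𝓘(ℝ, E) x)]

theorem IsParallelAlong.smul {γ : ℝ → M} {V : ∀ t, TangentSpace 𝓘(ℝ, E) (γ t)}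
    (hV : IsParallelAlong γ V) (a : ℝ) : IsParallelAlong γ (fun t ↦ a • V t) := by
  intro t ht
  obtain ⟨h1, h2⟩ := hV t ht
  have hrep : chartRep (γ t) γ (fun t ↦ a • V t) = a • chartRep (γ t) γ V :=
    funext fun τ ↦ chartRep_smul _ γ V a τ
  rw [hrep]
  refine ⟨h1.const_smul a, fun e ↦ ?_⟩
  rw [derivWithin_const_smul a h1, Pi.smul_apply, chartMetric_smul_left,
    christoffel_smul_middle _ (mem_extChartAt_target (γ t)), ← mul_add, h2 e, mul_zero]

/-- The parallel equation at `t` is `a` times the original one at `a * t`: the chain rule puts a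
factor `a` on the derivative of the field and on the velocity in the Christoffel term. -/
theorem IsParallelAlong.comp_mul_left {γ : ℝ → M} (hγ : IsGeodesic (E := E) γ)
    {V : ∀ t, TangentSpace 𝓘(ℝ, E) (γ t)} (hV : IsParallelAlong γ V) {a : ℝ}
    (ha : a ∈ Icc (0 : ℝ) 1) :
    IsParallelAlong (fun s ↦ γ (a * s)) (fun s ↦ V (a * s)) := by
  intro t ht
  have hat := mul_mem_Icc_zero_one ha ht
  obtain ⟨h1, h2⟩ := hV (a * t) hat
  have hd : HasDerivWithinAt
      (chartRep (γ (a * t)) (fun s ↦ γ (a * s)) (fun s ↦ V (a * s))) _ (Icc 0 1) t :=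
    hasDerivWithinAt_comp_mul_left ha h1.hasDerivWithinAt
  refine ⟨hd.differentiableWithinAt, fun e ↦ ?_⟩
  have hvel : chartRep (E := E) (γ (a * t)) (fun s ↦ γ (a * s)) (velocity (E := E) fun s ↦ γ (a * s)) t =
      a • chartRep (E := E) (γ (a * t)) γ (velocity γ) (a * t) := by
    rw [← chartRep_smul]
    unfold chartRep
    rw [velocity_comp_mul_left ha ht (hγ.mdifferentiableWithinAt hat)]
  have hrep : chartRep (γ (a * t)) (fun s ↦ γ (a * s)) (fun s ↦ V (a * s)) t =
    chartRep (γ (a * t)) γ V (a * t) := rfl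
  rw [hd.derivWithin (uniqueDiffOn_Icc_zero_one t ht), hvel, hrep, chartMetric_smul_left,
    christoffel_smul_left _ (mem_extChartAt_target _), ← mul_add, h2 e, mul_zero]

theorem IsGeodesic.comp_mul_left {γ : ℝ → M} (hγ : IsGeodesic (E := E) γ) {a : ℝ}
    (ha : a ∈ Icc (0 : ℝ) 1) : IsGeodesic (E := E) (fun s ↦ γ (a * s)) := by
  refine ⟨hγ.1.comp (contDiff_const.mul contDiff_id).contMDiff.contMDiffOn
    fun s hs ↦ mul_mem_Icc_zero_one ha hs, ?_⟩
  exact ((hγ.2.comp_mul_left hγ ha).smul a).congr fun t ht ↦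
    velocity_comp_mul_left ha ht (hγ.mdifferentiableWithinAt (mul_mem_Icc_zero_one ha ht))

variable [FiniteDimensional ℝ E]

/-- The Levi-Civita connection is metric: the inner product of parallel fields is constant. -/
theorem IsParallelAlong.inner_eq {γ : ℝ → M} (hγ : IsGeodesic (E := E) γ)
    {V W : ∀ t, TangentSpace 𝓘(ℝ, E) (γ t)} (hV : IsParallelAlong γ V)
    (hW : IsParallelAlong γ W) {s : ℝ} (hs : s ∈ Icc (0 : ℝ) 1) :
    inner ℝ (V s) (W s) = inner ℝ (V 0) (W 0) := by
  have hderiv (t : ℝ) (ht : t ∈ Icc (0 : ℝ) 1) :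
      HasDerivWithinAt (fun τ ↦ inner ℝ (V τ) (W τ)) 0 (Icc 0 1) t := by
    have hsource := mem_extChartAt_source (I := 𝓘(ℝ, E)) (γ t)
    obtain ⟨hV1, hV2⟩ := hV t ht
    obtain ⟨hW1, hW2⟩ := hW t ht
    have h := hasDerivWithinAt_chartMetric (γ t) (mem_extChartAt_target (γ t))
      (hasDerivWithinAt_extChartAt_comp hsource (hγ.mdifferentiableWithinAt ht))
      hV1.hasDerivWithinAt hW1.hasDerivWithinAt
    have hnear : ∀ᶠ τ in nhdsWithin t (Icc 0 1), γ τ ∈ (extChartAt 𝓘(ℝ, E) (γ t)).source :=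
      (hγ.mdifferentiableWithinAt ht).continuousWithinAt
        (extChartAt_source_mem_nhds (I := 𝓘(ℝ, E)) (γ t))
    refine (h.congr_of_eventuallyEq (hnear.mono fun τ hτ ↦
      (chartMetric_mfderiv hτ (V τ) (W τ)).symm)
      (chartMetric_mfderiv hsource (V t) (W t)).symm).congr_deriv ?_
    -- The derivative of the metric along the curve splits into two Christoffel terms; each parallel
    -- equation, tested against the other field, cancels one of them.
    rw [← christoffel_add_christoffel, chartMetric_comm _ _ _ (derivWithin _ _ _)]
    linear_combination hV2 (chartRep (γ t) γ W t) + hW2 (chartRep (γ t) γ V t)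
  exact constant_of_derivWithin_zero (fun t ht ↦ (hderiv t ht).differentiableWithinAt)
    (fun t ht ↦ (hderiv t (Ico_subset_Icc_self ht)).derivWithin
      (uniqueDiffOn_Icc_zero_one t (Ico_subset_Icc_self ht))) s hs

end Reparametrization

/-! ### Logarithms, double exponentials and parallel transport. -/

section ExponentialMap

theorem velocity_zero_congr {γ σ : ℝ → M} (h : EqOn γ σ (Icc 0 1)) :
    (⟨γ 0, velocity γ 0⟩ : TangentBundle 𝓘(ℝ, E) M) = ⟨σ 0, velocity σ 0⟩ := by
  have h0 : γ 0 = σ 0 := h ⟨le_rfl, zero_le_one⟩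
  have hd : velocity (E := E) γ 0 = velocity (E := E) σ 0 := by
    unfold velocity
    rw [mfderivWithin_congr h h0]
    rfl
  exact TotalSpace.ext h0 (heq_of_eq hd)

variable [IsManifold 𝓘(ℝ, E) ∞ M] [RiemannianBundle (fun x : M ↦ TangentSpace 𝓘(ℝ, E) x)]

/-- The logarithm is the initial velocity of any geodesic of a uniquely geodesic convex set. -/
theorem logMap_eq {C : Set M} (hconv : IsGeodesicallyConvex E C) (huniq : IsUniquelyGeodesic E C)
    {x y : M} (hx : x ∈ C) (hy : y ∈ C) {γ : ℝ → M} {u : TangentSpace 𝓘(ℝ, E) x}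
    (hγ : IsGeodesicInFromTo E C γ x y) (hu : IsGeodesicFrom γ x u) : logMap C x y = u := by
  have hunique : ∀ v ∈ logSet (E := E) C x y, v = u := by
    rintro v ⟨σ, hσv, hσ, -⟩
    have := hσv.2.symm.trans ((velocity_zero_congr (huniq x hx y hy σ γ hσ hγ)).trans hu.2)
    simpa using this
  obtain ⟨σ, hσ, hmin⟩ := hconv x hx y hy
  have hne : (logSet (E := E) C x y).Nonempty := by
    obtain rfl := hσ.2.2.1
    exact ⟨velocity σ 0, σ, ⟨hσ.1, rfl⟩, hσ, hmin⟩
  rw [logMap, dif_pos hne]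
  exact hunique _ hne.some_mem

/-- Cauchy–Schwarz bounds the maximum above; the normalization of `w` attains the bound. -/
theorem inner_maximizer_eq_norm {F : Type*} [NormedAddCommGroup F] [InnerProductSpace ℝ F]
    {w z : F} (hz : ‖z‖ = 1) (hmax : ∀ ζ : F, ‖ζ‖ = 1 → inner ℝ w ζ ≤ inner ℝ w z) :
    inner ℝ w z = ‖w‖ := by
  refine le_antisymm (by simpa [hz] using real_inner_le_norm w z) ?_
  rcases eq_or_ne w 0 with rfl | hw
  · simp
  · have hw' : ‖w‖ ≠ 0 := norm_ne_zero_iff.2 hw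
    have := hmax (‖w‖⁻¹ • w) (by simp [norm_smul, hw'])
    rwa [real_inner_smul_right, real_inner_self_eq_norm_sq, pow_two,
      inv_mul_cancel_left₀ hw'] at this

variable [IsContMDiffRiemannianBundle 𝓘(ℝ, E) ∞ E (fun x : M ↦ TangentSpace 𝓘(ℝ, E) x)]

theorem IsGeodesicFrom.comp_mul_left {γ : ℝ → M} {x : M} {u : TangentSpace 𝓘(ℝ, E) x}
    (hγ : IsGeodesicFrom γ x u) {a : ℝ} (ha : a ∈ Icc (0 : ℝ) 1) :
    IsGeodesicFrom (fun s ↦ γ (a * s)) x (a • u) := by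
  refine ⟨hγ.1.comp_mul_left ha, ?_⟩
  have h0 : (0 : ℝ) ∈ Icc (0 : ℝ) 1 := ⟨le_rfl, zero_le_one⟩
  have hx : γ 0 = x := congrArg TotalSpace.proj hγ.2
  subst hx
  obtain rfl : velocity γ 0 = u := by simpa using hγ.2
  have hv := velocity_comp_mul_left (E := E) ha h0
    (hγ.1.mdifferentiableWithinAt (mul_mem_Icc_zero_one ha h0))
  rw [hv]
  exact congrArg (fun b ↦ (⟨γ b, a • velocity γ b⟩ : TangentBundle 𝓘(ℝ, E) M)) (mul_zero a)

theorem logMap_self {C : Set M} (hconv : IsGeodesicallyConvex E C)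
    (huniq : IsUniquelyGeodesic E C) {x : M} (hx : x ∈ C) : logMap (E := E) C x x = 0 := by
  obtain ⟨γ, hγ, -⟩ := hconv x hx x hx
  obtain rfl := hγ.2.2.1
  have h0 : (0 : ℝ) ∈ Icc (0 : ℝ) 1 := ⟨le_rfl, zero_le_one⟩
  have hfrom : IsGeodesicFrom γ (γ 0) (velocity (E := E) γ 0) := ⟨hγ.1, rfl⟩
  -- Rescaling by `a = 0` yields the constant geodesic, with zero velocity.
  have hconst := hfrom.comp_mul_left h0
  rw [zero_smul] at hconst
  exact logMap_eq hconv huniq hx hx ⟨hconst.1, fun t _ ↦ by simpa using hx, by simp, by simp⟩ hconst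

/-- A pair of points of a geodesic at which the second geodesic branches off determines a double
exponential, with the first geodesic reparametrized to unit time. -/
theorem isDoubleExp_of_isExp {γ : ℝ → M} {x p : M} {u η : TangentSpace 𝓘(ℝ, E) x} {a : ℝ}
    (ha : a ∈ Icc (0 : ℝ) 1) (hγ : IsGeodesicFrom γ x u) {ξ : TangentSpace 𝓘(ℝ, E) (γ a)}
    (htr : IsParallelTransport γ a 0 ⟨γ a, ξ⟩ ⟨x, η⟩) (hexp : IsExp (γ a) ξ p) :
    IsDoubleExp x (a • u) η p := by
  obtain ⟨V, hV, hVa, hV0⟩ := htr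
  obtain rfl : V a = ξ := by simpa using hVa
  have htransport : IsParallelTransport (fun s ↦ γ (a * s)) 0 1 ⟨x, η⟩ ⟨γ (a * 1), V (a * 1)⟩ := by
    refine ⟨fun s ↦ V (a * s), hV.comp_mul_left hγ.1 ha, ?_, rfl⟩
    exact (congrArg (fun b ↦ (⟨γ b, V b⟩ : TangentBundle 𝓘(ℝ, E) M)) (mul_zero a)).trans hV0
  refine ⟨fun s ↦ γ (a * s), V (a * 1), hγ.comp_mul_left ha, htransport, ?_⟩
  -- The tangent space at `γ (a * 1)` is not definitionally that at `γ a`, so the basepoint is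
  -- generalized first.
  have hexp' : ∀ b, b = a → IsExp (γ b) (V b) p := by
    rintro b rfl
    exact hexp
  exact hexp' _ (mul_one a)

variable [FiniteDimensional ℝ E]

/-- The two transports may use unrelated parallel fields; constancy of the inner product of any two
makes uniqueness of transport unnecessary. -/
theorem IsParallelTransport.inner_eq {γ : ℝ → M} (hγ : IsGeodesic (E := E) γ) {x : M} {a : ℝ}
    (ha : a ∈ Icc (0 : ℝ) 1) {w η : TangentSpace 𝓘(ℝ, E) x} {w' ξ : TangentSpace 𝓘(ℝ, E) (γ a)}
    (hw : IsParallelTransport γ 0 a ⟨x, w⟩ ⟨γ a, w'⟩)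
    (hξ : IsParallelTransport γ a 0 ⟨γ a, ξ⟩ ⟨x, η⟩) :
    inner ℝ w η = inner ℝ w' ξ := by
  obtain ⟨V, hV, hV0, hVa⟩ := hw
  obtain ⟨W, hW, hWa, hW0⟩ := hξ
  have hx : γ 0 = x := congrArg TotalSpace.proj hV0
  subst hx
  obtain rfl : V 0 = w := by simpa using hV0
  obtain rfl : W 0 = η := by simpa using hW0
  obtain rfl : V a = w' := by simpa using hVa
  obtain rfl : W a = ξ := by simpa using hWa
  exact (hV.inner_eq hγ hW ha).symm

theorem IsParallelTransport.norm_eq {γ : ℝ → M} (hγ : IsGeodesic (E := E) γ) {x : M} {a : ℝ}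
    (ha : a ∈ Icc (0 : ℝ) 1) {w : TangentSpace 𝓘(ℝ, E) x} {w' : TangentSpace 𝓘(ℝ, E) (γ a)}
    (hw : IsParallelTransport γ 0 a ⟨x, w⟩ ⟨γ a, w'⟩) : ‖w'‖ = ‖w‖ := by
  have hback : IsParallelTransport γ a 0 ⟨γ a, w'⟩ ⟨x, w⟩ := by
    obtain ⟨V, hV, hV0, hVa⟩ := hw
    exact ⟨V, hV, hVa, hV0⟩
  have h := IsParallelTransport.inner_eq hγ ha hw hback
  rw [real_inner_self_eq_norm_sq, real_inner_self_eq_norm_sq] at h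
  exact ((sq_eq_sq₀ (norm_nonneg _) (norm_nonneg _)).1 h).symm

end ExponentialMap

end DoubleGeodesic

/-! ### The scaling inequalities. -/

theorem mainTheorem8
    {E : Type*} [NormedAddCommGroup E] [NormedSpace ℝ E] [FiniteDimensional ℝ E]
    {M : Type*} [TopologicalSpace M] [T2Space M] [ChartedSpace E M] [IsManifold 𝓘(ℝ, E) ∞ M]
    [RiemannianBundle (fun x : M ↦ TangentSpace 𝓘(ℝ, E) x)]
    [IsContMDiffRiemannianBundle 𝓘(ℝ, E) ∞ E (fun x : M ↦ TangentSpace 𝓘(ℝ, E) x)]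
    (d : M → M → ℝ) (hd : DoubleGeodesic.IsDistanceFunction d)
    (C : Set M)
    (hconv : DoubleGeodesic.IsGeodesicallyConvex E C)
    (huniq : DoubleGeodesic.IsUniquelyGeodesic E C)
    (α : ℝ) (hα : 0 < α)
    (hC : DoubleGeodesic.IsDoubleGeodesicallyStronglyConvex E C d α)
    (h R : ∀ x : M, TangentSpace 𝓘(ℝ, E) x → TangentSpace 𝓘(ℝ, E) x → TangentSpace 𝓘(ℝ, E) x)
    (hh : DoubleGeodesic.IsExpOperator C h)
    (hR : ∀ x ∈ C, ∀ u η : TangentSpace 𝓘(ℝ, E) x, h x u η = u + η + R x u η)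
    (r : ∀ x : M, TangentSpace 𝓘(ℝ, E) x → M → TangentSpace 𝓘(ℝ, E) x)
    (hr : ∀ x ∈ C, ∀ (w : TangentSpace 𝓘(ℝ, E) x) (v : M),
      DoubleGeodesic.IsLinearMaximizer C x w v →
        DoubleGeodesic.IsResidual C d α R x w v (r x w v)) :
    DoubleGeodesic.ApproxScalingInequality C d (α / 4) r ∧
    DoubleGeodesic.ApproxScalingInequality C d (α / 2) (fun x w v ↦ (2 : ℝ) • r x w v) := by
  have main (x : M) (hx : x ∈ C) (w : TangentSpace 𝓘(ℝ, E) x) (v : M)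
      (hv : DoubleGeodesic.IsLinearMaximizer C x w v) :
      0 ≤ inner ℝ w (DoubleGeodesic.logMap C x v) ∧
      α / 4 * ‖w‖ * d v x ^ 2 + inner ℝ w (r x w v) ≤
        1 / 2 * inner ℝ w (DoubleGeodesic.logMap C x v) := by
    have hhalf : (1 / 2 : ℝ) ∈ Icc (0 : ℝ) 1 := by constructor <;> norm_num
    constructor
    -- The competitor `x` has logarithm zero.
    · simpa [DoubleGeodesic.logMap_self hconv huniq hx] using hv.2 x hx
    obtain ⟨γ, u, η, w', z, hγ, hu, hw, hz, hmax, hη, hρ⟩ := hr x hx w v hv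
    have hnorm : ‖(α / 4 * d x v ^ 2) • z‖ ≤ α * (1 / 2) * (1 - 1 / 2) * d x v ^ 2 := by
      rw [norm_smul, hz, Real.norm_of_nonneg (by positivity)]
      exact le_of_eq (by ring)
    obtain ⟨p, hp, hexp⟩ := hC x hx v hv.1 γ hγ _ hhalf _ hnorm
    have hlog := (hh x hx _ _ p (DoubleGeodesic.isDoubleExp_of_isExp hhalf hu hη hexp)).2 hp
    have hle := hv.2 p hp
    -- After rewriting, `hle` says `½⟨w,u⟩ + (α/4) d(x,v)² ‖w‖ + ⟨w,r⟩ ≤ ⟨w,u⟩`.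
    rw [← hlog, hR x hx, ← hρ, inner_add_right, inner_add_right, real_inner_smul_right,
      DoubleGeodesic.IsParallelTransport.inner_eq hγ.1 hhalf hw hη, real_inner_smul_right,
      DoubleGeodesic.inner_maximizer_eq_norm hz hmax,
      DoubleGeodesic.IsParallelTransport.norm_eq hγ.1 hhalf hw,
      DoubleGeodesic.logMap_eq hconv huniq hx hv.1 hγ hu] at hle
    rw [DoubleGeodesic.logMap_eq hconv huniq hx hv.1 hγ hu, hd.symm v x]
    linarith
  constructor
  · intro x hx w v hv
    linarith [main x hx w v hv]
  · intro x hx w v hv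
    rw [real_inner_smul_right]
    linarith [main x hx w v hv]
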